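/- Let $n\ge 0$ and let $(H,\delta)$ be a finite sequence of Hilbert spaces (real or complex) and bounded linear operators $$0\to H_n\xrightarrow{\delta_n}H_{n-1}\to\cdots\to H_1\xrightarrow{\delta_1}H_0\to 0,\qquad \delta_p\in L(H_p,H_{p-1}),$$ with the convention $H_p=0$ and $\delta_p=0$ for $p<0$ and for $p\ge n+1$ (so $\delta_0=0$). Write $N(\cdot)$ and $R(\cdot)$ for null space and range, and suppose that $R(\delta_p\delta_{p+1})$ is finite dimensional for each $p\in\mathbb Z$. Call $(H,\delta)$ a Fredholm chain if $N(\delta_p)/(N(\delta_p)\cap R(\delta_{p+1}))$ and $R(\delta_{p+1})/(N(\delta_p)\cap R(\delta_{p+1}))$ are finite dimensional for $p=0,\dots,n$; in that case its index is $$\operatorname{ind}(H,\delta)=\sum_{p=0}^n(-1)^p\left(\dim \frac{N(\delta_p)}{N(\delta_p)\cap R(\delta_{p+1})}-\dim\frac{R(\delta_{p+1})}{N(\delta_p)\cap R(\delta_{p+1})}\right).$$ Let $$D_{\mathrm{ev}}=\bigoplus_{p\text{ even}}(\delta_p+\delta_{p+1}^*)\colon\bigoplus_{p\text{ even}}H_p\to\bigoplus_{p\text{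 odd}}H_p,\qquad D_{\mathrm{odd}}=\bigoplus_{p\text{ odd}}(\delta_p+\delta_{p+1}^*)\colon\bigoplus_{p\text{ odd}}H_p\to\bigoplus_{p\text{ even}}H_p$$ be the bounded operators between Hilbert direct sums that map $x\in H_p$ to $\delta_px+\delta_{p+1}^*x$, where $\delta_px\in H_{p-1}$ and $\delta_{p+1}^*x\in H_{p+1}$. Then the following statements are equivalent: (i) $(H,\delta)$ is a Fredholm chain; (ii) $D_{\mathrm{ev}}$ is a Fredholm operator; (iii) $D_{\mathrm{odd}}$ is a Fredholm operator. Furthermore, in this case $$\operatorname{ind}(H,\delta)=\operatorname{ind}D_{\mathrm{ev}}=-\operatorname{ind}D_{\mathrm{odd}},$$ where $\operatorname{ind}D=\dim N(D)-\dim\big(\text{codomain of }D\,/\,R(D)\big)$ for a Fredholm operator $D$. -/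

import Mathlib

noncomputable section

/-- A finite sequence of Hilbert spaces and bounded operators
`0 → H_n → H_{n-1} → ⋯ → H_1 → H_0 → 0`, indexed by `ℤ` with `H_p = 0` for `p < 0` and for
`p ≥ n + 1`. The operator `δ_p : H_p → H_{p-1}` is `d p (p - 1)`; the maps `d p q` with
`q + 1 ≠ p` carry no information and are set to zero. The composites `δ_p δ_{p+1}` are not
assumed to vanish. -/
structure HilbertSequence (𝕜 : Type*) [RCLike 𝕜] (H : ℤ → Type*)
    [∀ p, NormedAddCommGroup (H p)] [∀ p, InnerProductSpace 𝕜 (H p)] (n : ℕ) where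
  d : ∀ p q : ℤ, H p →L[𝕜] H q
  shape : ∀ p q : ℤ, q + 1 ≠ p → d p q = 0
  bounded : ∀ p : ℤ, p < 0 ∨ (n : ℤ) + 1 ≤ p → Subsingleton (H p)

namespace HilbertSequence

variable {𝕜 : Type*} [RCLike 𝕜] {H : ℤ → Type*}
  [∀ p, NormedAddCommGroup (H p)] [∀ p, InnerProductSpace 𝕜 (H p)] {n : ℕ}

/-- The operator `δ_p : H_p → H_{p-1}`. -/
abbrev δ (X : HilbertSequence 𝕜 H n) (p : ℤ) : H p →L[𝕜] H (p - 1) := X.d p (p - 1)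

/-- The null space `N(δ_p)`. -/
abbrev N (X : HilbertSequence 𝕜 H n) (p : ℤ) : Submodule 𝕜 (H p) := (X.δ p).ker

/-- The range `R(δ_{p+1})`, a subspace of `H_p`. -/
abbrev R (X : HilbertSequence 𝕜 H n) (p : ℤ) : Submodule 𝕜 (H p) := (X.d (p + 1) p).range

/-- The quotient `N(δ_p) / (N(δ_p) ∩ R(δ_{p+1}))`. -/
abbrev NQuot (X : HilbertSequence 𝕜 H n) (p : ℤ) : Type _ :=
  ↥(X.N p) ⧸ (X.N p ⊓ X.R p).submoduleOf (X.N p)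

/-- The quotient `R(δ_{p+1}) / (N(δ_p) ∩ R(δ_{p+1}))`. -/
abbrev RQuot (X : HilbertSequence 𝕜 H n) (p : ℤ) : Type _ :=
  ↥(X.R p) ⧸ (X.N p ⊓ X.R p).submoduleOf (X.R p)

/-- `(H, δ)` is a Fredholm chain. -/
def IsFredholmChain (X : HilbertSequence 𝕜 H n) : Prop :=
  ∀ p : ℤ, 0 ≤ p → p ≤ n →
    FiniteDimensional 𝕜 (X.NQuot p) ∧ FiniteDimensional 𝕜 (X.RQuot p)

/-- The index of a Fredholm chain. -/
def index (X : HilbertSequence 𝕜 H n) : ℤ :=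
  ∑ p ∈ Finset.range (n + 1), (-1 : ℤ) ^ p *
    ((Module.finrank 𝕜 (X.NQuot p) : ℤ) - (Module.finrank 𝕜 (X.RQuot p) : ℤ))

/-- The even degrees among `0, …, n`. -/
def evens (n : ℕ) : Finset ℤ := {p ∈ Finset.Icc 0 (n : ℤ) | Even p}

/-- The odd degrees among `0, …, n`. -/
def odds (n : ℕ) : Finset ℤ := {p ∈ Finset.Icc 0 (n : ℤ) | Odd p}

/-- The Hilbert direct sum `⊕_{p ∈ I} H_p` over a finite set `I` of degrees. -/
abbrev Sum (H : ℤ → Type*) (I : Finset ℤ) : Type _ := PiLp 2 (fun p : I => H p)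

variable [∀ p, CompleteSpace (H p)]

/-- The operator `⊕_{p ∈ I} (δ_p + δ_{p+1}^*)` from `⊕_{p ∈ I} H_p` to `⊕_{q ∈ J} H_q`: the
summand `H_p` is mapped to `H_{p-1} ⊕ H_{p+1}` by `x ↦ (δ_p x, δ_{p+1}^* x)`, and contributions
to the same target summand are added. The block from `H_p` to `H_q` is `d p q + (d q p)^*`, that
is `δ_p` for `q = p - 1`, `δ_{p+1}^*` for `q = p + 1`, and zero otherwise. -/
def sumOp (X : HilbertSequence 𝕜 H n) (I J : Finset ℤ) : Sum H I →L[𝕜] Sum H J :=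
  ((PiLp.continuousLinearEquiv 2 𝕜 (fun q : J => H q)).symm : (∀ q : J, H q) →L[𝕜] Sum H J) ∘L
    ContinuousLinearMap.pi fun q : J => ∑ p : I,
      (X.d p q + ContinuousLinearMap.adjoint (X.d q p)) ∘L PiLp.proj 2 (fun p : I => H p) p

/-- `⊕_{p even} (δ_p + δ_{p+1}^*) : ⊕_{p even} H_p → ⊕_{p odd} H_p`. -/
def evenOp (X : HilbertSequence 𝕜 H n) : Sum H (evens n) →L[𝕜] Sum H (odds n) :=
  X.sumOp (evens n) (odds n)

/-- `⊕_{p odd} (δ_p + δ_{p+1}^*) : ⊕_{p odd} H_p → ⊕_{p even} H_p`. -/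
def oddOp (X : HilbertSequence 𝕜 H n) : Sum H (odds n) →L[𝕜] Sum H (evens n) :=
  X.sumOp (odds n) (evens n)

end HilbertSequence

end

/-! For a complex (`δ_p δ_{p+1} = 0`) this is Hodge theory. The equations `δ_p z = a` and `δ_{p+1}^*
z = b` can be solved independently, so the range of `D` is the direct sum of the subspaces
`R(δ_{q+1}) + R(δ_q^*)` (`mem_range_sumOp_iff`). If the homology is finite-dimensional, the ranges
are closed and `R(δ_q^*) = N(δ_q)ᗮ`, so the cokernel of `D` is the sum of the homology spaces of one
parity (`nonempty_NQuot_equiv`). Since `D_odd = D_ev^*`, Fredholmness and index can be read off from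
the two cokernels.

In general, put `δ'_p = P_{N(δ_{p-1})} δ_p`. This is a complex, and `δ'_p = δ_p` on the
finite-codimensional space `N(δ_{p-1} δ_p)`. Hence `D` changes by a finite-rank operator, which
affects neither Fredholmness nor index. On the chain side, with `k_p = dim N(δ'_p)/N(δ_p)`, the
contribution of degree `p` to the index changes by `k_p + k_{p+1}` (`finrank_toComplex_NQuot`). The
alternating sum of these corrections telescopes to zero. -/

noncomputable section

open ContinuousLinearMap Submodule
open scoped InnerProductSpace

/-! ### Closed ranges, adjoints and Fredholm operators on Hilbert spaces -/

section Operators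

variable {𝕜 E F G : Type*} [RCLike 𝕜]
  [NormedAddCommGroup E] [InnerProductSpace 𝕜 E] [CompleteSpace E]
  [NormedAddCommGroup F] [InnerProductSpace 𝕜 F] [CompleteSpace F]
  [NormedAddCommGroup G] [InnerProductSpace 𝕜 G] [CompleteSpace G]

omit [CompleteSpace E] [CompleteSpace F] in
/-- An operator is injective on the orthogonal complement of its kernel. -/
theorem ContinuousLinearMap.ker_domRestrict_orthogonal_ker (u : E →L[𝕜] F) :
    (u.domRestrict u.kerᗮ).ker = ⊥ := by
  rw [eq_bot_iff]
  intro x hx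
  have h1 : (x : E) ∈ u.ker := by simpa using hx
  have : (x : E) = 0 := by
    simpa using (u.ker.orthogonal_disjoint.le_bot ⟨h1, x.2⟩ : (x : E) ∈ (⊥ : Submodule 𝕜 E))
  simpa using this

omit [CompleteSpace F] in
theorem ContinuousLinearMap.range_domRestrict_orthogonal_ker (u : E →L[𝕜] F) :
    (u.domRestrict u.kerᗮ).range = u.range := by
  apply le_antisymm
  · rintro _ ⟨x, rfl⟩
    exact ⟨x, rfl⟩
  · rintro _ ⟨x, rfl⟩
    have : x ∈ u.ker ⊔ u.kerᗮ := by
      rw [sup_orthogonal_of_hasOrthogonalProjection]; trivial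
    obtain ⟨y, hy, z, hz, rfl⟩ := mem_sup.mp this
    refine ⟨⟨z, hz⟩, ?_⟩
    have hy' : u y = 0 := hy
    simp [hy']

/-- An operator between Hilbert spaces whose range has finite codimension has closed range. -/
theorem ContinuousLinearMap.isClosed_range_of_coFG (u : E →L[𝕜] F) (h : u.range.CoFG) :
    IsClosed (u.range : Set F) := by
  obtain ⟨G, hG⟩ := u.range.exists_isCompl
  have : FiniteDimensional 𝕜 G := .of_fg (h.fg_of_isCompl hG)
  have := closed_complemented_range_of_isCompl_of_ker_eq_bot (u.domRestrict u.kerᗮ) G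
    (by rw [u.range_domRestrict_orthogonal_ker]; exact hG) G.closed_of_finiteDimensional
    u.ker_domRestrict_orthogonal_ker
  rwa [u.range_domRestrict_orthogonal_ker] at this

/-- The closed range theorem for operators between Hilbert spaces. -/
theorem ContinuousLinearMap.range_adjoint_of_isClosed_range (u : E →L[𝕜] F)
    (h : IsClosed (u.range : Set F)) : (adjoint u).range = u.kerᗮ := by
  have hle : (adjoint u).range ≤ u.kerᗮ := by
    rw [u.orthogonal_ker]
    exact le_topologicalClosure _
  apply le_antisymm hle
  set f := u.domRestrict u.kerᗮ
  have hr : f.range = u.range := u.range_domRestrict_orthogonal_ker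
  have hcl : IsClosed (f.range : Set F) := hr ▸ h
  have : CompleteSpace f.range := hcl.completeSpace_coe
  have hinv : f.HasLeftInverse :=
    .of_injective_of_isClosed_range_of_closedComplement_range
      (LinearMap.ker_eq_bot.mp u.ker_domRestrict_orthogonal_ker) hcl
      (f.range.isCompl_orthogonal.closedComplemented_of_isClosed hcl f.range.isClosed_orthogonal)
  obtain ⟨g, hg⟩ := hinv
  intro x hx
  -- With `g` a left inverse of `u` on `u.kerᗮ`, `⟪u† g† x, z⟫ = ⟪x, g (u z)⟫ = ⟪x, z⟫` for `z` in
  -- `u.kerᗮ`.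
  refine ⟨adjoint g ⟨x, hx⟩, ?_⟩
  refine ext_inner_right 𝕜 fun y => ?_
  have hmem : y ∈ u.ker ⊔ u.kerᗮ := by
    rw [sup_orthogonal_of_hasOrthogonalProjection]; trivial
  obtain ⟨y, hy, z, hz, rfl⟩ := mem_sup.mp hmem
  have hy' : u y = 0 := hy
  have hz' : u z = f ⟨z, hz⟩ := rfl
  rw [coe_coe, adjoint_inner_left, map_add, hy', zero_add, hz', adjoint_inner_left, hg,
    inner_add_right, inner_left_of_mem_orthogonal hy hx, zero_add]
  rfl

/-- For an operator with range of finite codimension, the kernel of the adjoint is isomorphic to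
the cokernel. -/
theorem ContinuousLinearMap.nonempty_ker_adjoint_equiv (u : E →L[𝕜] F) (h : u.range.CoFG) :
    Nonempty ((adjoint u).ker ≃ₗ[𝕜] F ⧸ u.range) := by
  have : CompleteSpace u.range := (u.isClosed_range_of_coFG h).completeSpace_coe
  rw [← u.orthogonal_range]
  exact ⟨(quotientEquivOfIsCompl _ _ u.range.isCompl_orthogonal).symm⟩

/-- A bounded operator between Hilbert spaces with finite-dimensional kernel and cokernel is
Fredholm. -/
theorem ContinuousLinearMap.IsFredholm.of_finite (u : E →L[𝕜] F) (hk : FiniteDimensional 𝕜 u.ker)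
    (hr : u.range.CoFG) : u.IsFredholm := by
  have hcl := u.isClosed_range_of_coFG hr
  have : CompleteSpace u.range := hcl.completeSpace_coe
  have hmaps : Set.MapsTo u u.kerᗮ u.range := fun x _ => ⟨x, rfl⟩
  have hco : u.kerᗮ.CoFG :=
    FG.cofg_of_isCompl u.ker.isCompl_orthogonal (fg_iff_finiteDimensional _ |>.mpr hk)
  refine .of_isInvertible_restrict u.ker.isClosed_orthogonal hcl hmaps ?_
  refine ⟨ContinuousLinearEquiv.ofBijective (u.restrict hmaps) ?_ ?_, rfl⟩
  · rw [eq_bot_iff, ← u.ker_domRestrict_orthogonal_ker]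
    intro x hx
    have : u.restrict hmaps x = 0 := hx
    exact congrArg Subtype.val this
  · rw [eq_top_iff]
    rintro ⟨y, hy⟩ -
    rw [← u.range_domRestrict_orthogonal_ker] at hy
    obtain ⟨x, hx⟩ := hy
    exact ⟨x, Subtype.ext hx⟩

/-- An operator between Hilbert spaces is Fredholm iff it and its adjoint have
finite-dimensional cokernels. -/
theorem ContinuousLinearMap.isFredholm_iff_coFG_range (u : E →L[𝕜] F) :
    u.IsFredholm ↔ u.range.CoFG ∧ (adjoint u).range.CoFG := by
  constructor
  · intro h
    refine ⟨h.finite_coker, ?_⟩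
    rw [u.range_adjoint_of_isClosed_range h.isClosed_range]
    have := h.finite_ker
    exact FG.cofg_of_isCompl u.ker.isCompl_orthogonal (fg_iff_finiteDimensional _ |>.mpr this)
  · rintro ⟨h1, h2⟩
    obtain ⟨e⟩ := (adjoint u).nonempty_ker_adjoint_equiv h2
    rw [adjoint_adjoint] at e
    have := h2
    exact .of_finite u e.symm.finiteDimensional h1

/-- Trades the kernel for the cokernel of the adjoint, so that only cokernels need to be computed.
-/
theorem ContinuousLinearMap.index_eq_finrank_coker_adjoint_sub (u : E →L[𝕜] F)
    (h : (adjoint u).range.CoFG) :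
    u.toLinearMap.index =
      (Module.finrank 𝕜 (E ⧸ (adjoint u).range) : ℤ) - Module.finrank 𝕜 (F ⧸ u.range) := by
  obtain ⟨e⟩ := (adjoint u).nonempty_ker_adjoint_equiv h
  rw [adjoint_adjoint] at e
  rw [LinearMap.index_eq_finrank_sub, e.finrank_eq]

omit [CompleteSpace F] in
/-- If `f ∘ g = 0`, then `f z = a` and `g† z = b` can be solved simultaneously. -/
theorem ContinuousLinearMap.exists_apply_eq_and_adjoint_apply_eq (f : E →L[𝕜] F) (g : G →L[𝕜] E)
    (hfg : ∀ x, f (g x) = 0) {a : F} {b : G} (ha : a ∈ f.range) (hb : b ∈ (adjoint g).range) :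
    ∃ z, f z = a ∧ adjoint g z = b := by
  rw [← f.range_domRestrict_orthogonal_ker] at ha
  rw [← (adjoint g).range_domRestrict_orthogonal_ker] at hb
  obtain ⟨⟨x, hx⟩, rfl⟩ := ha
  obtain ⟨⟨y, hy⟩, rfl⟩ := hb
  have hgf : g.range ≤ f.ker := by
    rintro _ ⟨x, rfl⟩
    exact hfg x
  -- The solutions orthogonal to the kernels do not interact: `x ∈ (ker f)ᗮ ⊆ R(g)ᗮ = ker g†`, and
  -- `y ∈ (ker g†)ᗮ = R(g)ᗮᗮ ⊆ ker f`.
  have h1 : adjoint g x = 0 := by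
    have : x ∈ g.rangeᗮ := orthogonal_le hgf hx
    rwa [g.orthogonal_range] at this
  have h2 : f y = 0 := by
    rw [← g.orthogonal_range] at hy
    have : y ∈ f.ker := by
      rw [← f.ker.orthogonal_orthogonal]
      exact orthogonal_le (orthogonal_le hgf) hy
    exact this
  exact ⟨x + y, by simp [h2], by simp [h1]⟩

/-- The adjoint of a finite-rank operator has finite rank. -/
theorem ContinuousLinearMap.hasFiniteRange_adjoint (u : E →L[𝕜] F)
    (h : u.toLinearMap.HasFiniteRange) : (adjoint u).toLinearMap.HasFiniteRange := by
  have hfin : FiniteDimensional 𝕜 u.range := .of_fg h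
  rw [LinearMap.hasFiniteRange_iff_range,
    u.range_adjoint_of_isClosed_range u.range.closed_of_finiteDimensional]
  exact h.cofg_ker.fg_of_isCompl u.ker.isCompl_orthogonal

open scoped LinearMap.FiniteRangeSetoid

omit [CompleteSpace E] [CompleteSpace F] in
theorem ContinuousLinearMap.IsFredholm.congr {u v : E →L[𝕜] F} (hu : u.IsFredholm)
    (h : (v - u).toLinearMap.HasFiniteRange) : v.IsFredholm := by
  obtain ⟨w, hw⟩ := hu.exists_isQuasiInverse
  exact .of_isQuasiInverse (v := w)
    (hw.congr (Setoid.refl _) (LinearMap.FiniteRangeSetoid.equiv_iff_hasFiniteRange.mpr h))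

end Operators

/-! ### Finite-rank perturbations and the index -/

section Index

variable {k M N : Type*} [Field k] [AddCommGroup M] [Module k M] [AddCommGroup N] [Module k N]

/-- The index is invariant under finite-rank perturbations. -/
theorem LinearMap.index_eq_of_hasFiniteRange_sub {f g : M →ₗ[k] N}
    [FiniteDimensional k f.ker] [FiniteDimensional k g.ker]
    [FiniteDimensional k (N ⧸ f.range)] [FiniteDimensional k (N ⧸ g.range)]
    (h : (f - g).HasFiniteRange) : f.index = g.index := by
  -- Both maps have the same restriction to `K`, and additivity of the index under composition
  -- cancels the index of the inclusion of `K`.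
  set K := (f - g).ker
  have hK : FiniteDimensional k (M ⧸ K) := h.cofg_ker
  have : FiniteDimensional k (M ⧸ K.subtype.range) := by rwa [range_subtype]
  have : FiniteDimensional k K.subtype.ker := by rw [ker_subtype]; infer_instance
  have heq : f ∘ₗ K.subtype = g ∘ₗ K.subtype := by
    ext x
    have hx : (f - g) x = 0 := x.2
    exact sub_eq_zero.mp hx
  have := congrArg LinearMap.index heq
  rw [LinearMap.index_comp, LinearMap.index_comp] at this
  linarith

end Index
end

noncomputable section

open Submodule

/-! ### Relative dimensions of subspaces -/

section RelativeDimension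

variable {k V W : Type*} [Field k] [AddCommGroup V] [Module k V] [AddCommGroup W] [Module k W]

/-- The relative dimension of nested subspaces is additive in towers. -/
theorem Submodule.finite_and_finrank_quotient_tower {C B A : Submodule k V} (hCB : C ≤ B)
    (hBA : B ≤ A) :
    (FiniteDimensional k (A ⧸ C.submoduleOf A) ↔
      FiniteDimensional k (A ⧸ B.submoduleOf A) ∧ FiniteDimensional k (B ⧸ C.submoduleOf B)) ∧
    (FiniteDimensional k (A ⧸ C.submoduleOf A) →
      Module.finrank k (A ⧸ C.submoduleOf A) =
        Module.finrank k (A ⧸ B.submoduleOf A) + Module.finrank k (B ⧸ C.submoduleOf B)) := by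
  have hle : C.submoduleOf A ≤ B.submoduleOf A := comap_mono hCB
  -- The exact sequence `0 → B/C → A/C → A/B → 0`, with maps `g` and `f`.
  let f : (A ⧸ C.submoduleOf A) →ₗ[k] A ⧸ B.submoduleOf A := factor hle
  have hf : f.range = ⊤ := LinearMap.range_eq_top.mpr (factor_surjective hle)
  let g : (B ⧸ C.submoduleOf B) →ₗ[k] A ⧸ C.submoduleOf A :=
    mapQ _ _ (inclusion hBA) (fun x hx => hx)
  have hg : g.ker = ⊥ := by
    rw [eq_bot_iff]
    intro x hx
    obtain ⟨x, rfl⟩ := Submodule.Quotient.mk_surjective _ x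
    have hx' : (Submodule.Quotient.mk (inclusion hBA x) : A ⧸ C.submoduleOf A) = 0 := hx
    rw [Submodule.Quotient.mk_eq_zero] at hx'
    rw [mem_bot, Submodule.Quotient.mk_eq_zero]
    exact hx'
  have hgf : g.range = f.ker := by
    ext x
    obtain ⟨x, rfl⟩ := Submodule.Quotient.mk_surjective _ x
    constructor
    · rintro ⟨y, hy⟩
      obtain ⟨y, rfl⟩ := Submodule.Quotient.mk_surjective _ y
      rw [← hy]
      change (Submodule.Quotient.mk (inclusion hBA y) : A ⧸ B.submoduleOf A) = 0
      rw [Submodule.Quotient.mk_eq_zero]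
      exact y.2
    · intro hx
      have hx' : (Submodule.Quotient.mk x : A ⧸ B.submoduleOf A) = 0 := hx
      rw [Submodule.Quotient.mk_eq_zero] at hx'
      exact ⟨Submodule.Quotient.mk ⟨x, hx'⟩, rfl⟩
  let e : (B ⧸ C.submoduleOf B) ≃ₗ[k] f.ker :=
    (LinearEquiv.ofInjective g (LinearMap.ker_eq_bot.mp hg)).trans (LinearEquiv.ofEq _ _ hgf)
  refine ⟨⟨fun h => ⟨?_, ?_⟩, fun ⟨h1, h2⟩ => ?_⟩, fun h => ?_⟩
  · exact Module.Finite.of_surjective f (factor_surjective hle)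
  · exact e.symm.finiteDimensional
  · have : FiniteDimensional k f.ker := e.finiteDimensional
    have : FiniteDimensional k ((A ⧸ C.submoduleOf A) ⧸ f.ker) :=
      (f.quotKerEquivRange.trans (LinearEquiv.ofTop _ hf)).symm.finiteDimensional
    exact Module.Finite.of_submodule_quotient f.ker
  · rw [← f.finrank_range_add_finrank_ker, hf, finrank_top, e.finrank_eq]

/-- A linear map `f` induces `V / (ker f + K) ≃ range f / f(K)`. -/
theorem LinearMap.nonempty_quotient_ker_sup_equiv (f : V →ₗ[k] W) (K : Submodule k V) :
    Nonempty ((V ⧸ (f.ker ⊔ K)) ≃ₗ[k] f.range ⧸ (K.map f).submoduleOf f.range) := by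
  let g := ((K.map f).submoduleOf f.range).mkQ ∘ₗ f.rangeRestrict
  have hg : f.ker ⊔ K = g.ker := by
    rw [LinearMap.ker_comp, ker_mkQ, sup_comm, ← comap_map_eq]
    rfl
  exact ⟨(quotEquivOfEq _ _ hg).trans
    (g.quotKerEquivOfSurjective ((mkQ_surjective _).comp f.surjective_rangeRestrict))⟩

/-- Rank-nullity for a perturbation: if `f` and `g` agree on `K ⊇ ker f` of finite codimension, and
`ker g ∩ K = ker f`, then `dim (range f / f(K)) = dim (range g / f(K)) + dim (ker g / ker f)`. -/
theorem LinearMap.finite_and_finrank_of_eqOn {f g : V →ₗ[k] W} {K : Submodule k V}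
    (hfg : ∀ x ∈ K, f x = g x) (hfK : f.ker ≤ K) (hgK : g.ker ⊓ K = f.ker)
    [FiniteDimensional k (V ⧸ K)] :
    FiniteDimensional k (f.range ⧸ (K.map f).submoduleOf f.range) ∧
    FiniteDimensional k (g.range ⧸ (K.map f).submoduleOf g.range) ∧
    FiniteDimensional k (g.ker ⧸ f.ker.submoduleOf g.ker) ∧
    Module.finrank k (f.range ⧸ (K.map f).submoduleOf f.range) =
      Module.finrank k (g.range ⧸ (K.map f).submoduleOf g.range) +
        Module.finrank k (g.ker ⧸ f.ker.submoduleOf g.ker) := by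
  have hmap : K.map f = K.map g := by
    ext y
    constructor
    · rintro ⟨x, hx, rfl⟩
      exact ⟨x, hx, (hfg x hx).symm⟩
    · rintro ⟨x, hx, rfl⟩
      exact ⟨x, hx, hfg x hx⟩
  -- Here `V/K ≃ range f / f(K)` and `V/(ker g + K) ≃ range g / f(K)`; the two differ by `(ker g +
  -- K)/K ≃ ker g / ker f`.
  obtain ⟨e₁⟩ := f.nonempty_quotient_ker_sup_equiv K
  obtain ⟨e₂⟩ := g.nonempty_quotient_ker_sup_equiv K
  rw [← hmap] at e₂
  rw [sup_eq_right.mpr hfK] at e₁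
  let φ : g.ker →ₗ[k] V ⧸ K := K.mkQ.domRestrict g.ker
  have hker : φ.ker = f.ker.submoduleOf g.ker := by
    ext x
    have h : (x : V) ∈ K ↔ (x : V) ∈ f.ker := by
      rw [← hgK]
      exact ⟨fun h => ⟨x.2, h⟩, fun h => h.2⟩
    change K.mkQ x = 0 ↔ (x : V) ∈ f.ker
    rw [← h, mkQ_apply, Submodule.Quotient.mk_eq_zero]
  have hrange : φ.range = (g.ker ⊔ K).map K.mkQ := by
    rw [Submodule.map_sup, mkQ_map_self, sup_bot_eq]
    exact LinearMap.range_domRestrict _ _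
  let e₃ : (g.ker ⧸ f.ker.submoduleOf g.ker) ≃ₗ[k] ((g.ker ⊔ K).map K.mkQ : Submodule k (V ⧸ K)) :=
    ((quotEquivOfEq _ _ hker.symm).trans φ.quotKerEquivRange).trans (LinearEquiv.ofEq _ _ hrange)
  let e₄ := (quotientQuotientEquivQuotient K (g.ker ⊔ K) le_sup_right).trans e₂
  refine ⟨e₁.finiteDimensional, e₄.finiteDimensional, e₃.symm.finiteDimensional, ?_⟩
  rw [← e₁.finrank_eq, ← e₄.finrank_eq, e₃.finrank_eq, finrank_quotient_add_finrank]

/-- The relative dimension of `B ≤ A` agrees with the codimension of `B + A'`, for a complement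
`A'` of `A`. -/
theorem Submodule.nonempty_quotient_sup_equiv_of_isCompl {A A' B : Submodule k V}
    (h : IsCompl A A') (hBA : B ≤ A) :
    Nonempty ((A ⧸ B.submoduleOf A) ≃ₗ[k] V ⧸ (B ⊔ A')) := by
  let φ : A →ₗ[k] V ⧸ (B ⊔ A') := (B ⊔ A').mkQ.domRestrict A
  have hker : φ.ker = B.submoduleOf A := by
    ext x
    change (B ⊔ A').mkQ x = 0 ↔ (x : V) ∈ B
    rw [mkQ_apply, Submodule.Quotient.mk_eq_zero]
    refine ⟨fun hx => ?_, fun hx => mem_sup_left hx⟩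
    obtain ⟨b, hb, a, ha, hab⟩ := mem_sup.mp hx
    have haA : a ∈ A := by
      have : a = x - b := by rw [← hab]; abel
      rw [this]
      exact A.sub_mem x.2 (hBA hb)
    have : a = 0 := by simpa using h.disjoint.le_bot ⟨haA, ha⟩
    rw [← hab, this, add_zero]
    exact hb
  have hsurj : Function.Surjective φ := by
    intro y
    obtain ⟨y, rfl⟩ := Submodule.Quotient.mk_surjective _ y
    have : y ∈ A ⊔ A' := by rw [h.sup_eq_top]; trivial
    obtain ⟨a, ha, b, hb, rfl⟩ := mem_sup.mp this
    refine ⟨⟨a, ha⟩, ?_⟩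
    change Submodule.Quotient.mk a = _
    rw [Submodule.Quotient.eq]
    simpa using mem_sup_right hb
  exact ⟨(quotEquivOfEq _ _ hker.symm).trans (φ.quotKerEquivOfSurjective hsurj)⟩

/-- If `B ≤ A` and `A'` is disjoint from `A`, then `A / B` is finite-dimensional as soon as `B + A'`
has finite codimension. -/
theorem Submodule.finite_quotient_submoduleOf_of_disjoint {A A' B : Submodule k V}
    (h : Disjoint A A') (hBA : B ≤ A) [FiniteDimensional k (V ⧸ (B ⊔ A'))] :
    FiniteDimensional k (A ⧸ B.submoduleOf A) := by
  let φ : (A ⧸ B.submoduleOf A) →ₗ[k] V ⧸ (B ⊔ A') :=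
    mapQ _ _ A.subtype (fun x hx => mem_sup_left hx)
  refine FiniteDimensional.of_injective φ (LinearMap.ker_eq_bot.mp ?_)
  rw [eq_bot_iff]
  intro x hx
  obtain ⟨x, rfl⟩ := Submodule.Quotient.mk_surjective _ x
  have hx' : (Submodule.Quotient.mk (x : V) : V ⧸ (B ⊔ A')) = 0 := hx
  rw [Submodule.Quotient.mk_eq_zero] at hx'
  obtain ⟨b, hb, a, ha, hab⟩ := mem_sup.mp hx'
  have haA : a ∈ A := by
    have : a = x - b := by rw [← hab]; abel
    rw [this]
    exact A.sub_mem x.2 (hBA hb)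
  have : a = 0 := by simpa using h.le_bot ⟨haA, ha⟩
  rw [mem_bot, Submodule.Quotient.mk_eq_zero]
  change (x : V) ∈ B
  rw [← hab, this, add_zero]
  exact hb

end RelativeDimension
end

/-! ### The operators `D` and their cokernels -/

noncomputable section

open Submodule ContinuousLinearMap
open scoped InnerProductSpace

namespace HilbertSequence

variable {𝕜 : Type*} [RCLike 𝕜] {H : ℤ → Type*}
  [∀ p, NormedAddCommGroup (H p)] [∀ p, InnerProductSpace 𝕜 (H p)] {n : ℕ}
  [∀ p, CompleteSpace (H p)]

theorem sumOp_apply (X : HilbertSequence 𝕜 H n) (I J : Finset ℤ) (x : Sum H I) (q : J) :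
    X.sumOp I J x q = ∑ p : I, (X.d p q (x p) + adjoint (X.d q p) (x p)) := by
  simp [sumOp]

/-- Taking the adjoint of the block `d p q + (d q p)†` amounts to swapping `p` and `q`. -/
theorem adjoint_sumOp (X : HilbertSequence 𝕜 H n) (I J : Finset ℤ) :
    adjoint (X.sumOp I J) = X.sumOp J I := by
  symm
  rw [eq_adjoint_iff]
  intro x y
  simp only [PiLp.inner_apply, sumOp_apply, sum_inner, inner_sum, inner_add_left, inner_add_right,
    adjoint_inner_left, adjoint_inner_right]
  rw [Finset.sum_comm]
  refine Finset.sum_congr rfl fun _ _ => Finset.sum_congr rfl fun _ _ => add_comm _ _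

-- The two operators agree on the intersection of the kernels of the finitely many block
-- differences, each of finite codimension.
open scoped LinearMap.FiniteRangeSetoid in
theorem hasFiniteRange_sumOp_sub (X Y : HilbertSequence 𝕜 H n)
    (h : ∀ p q, (X.d p q - Y.d p q).toLinearMap.HasFiniteRange) (I J : Finset ℤ) :
    (X.sumOp I J - Y.sumOp I J).toLinearMap.HasFiniteRange := by
  let T (s : I × J) : Sum H I →ₗ[𝕜] H s.2 :=
    ((X.d s.1 s.2 - Y.d s.1 s.2) + adjoint (X.d s.2 s.1 - Y.d s.2 s.1)).toLinearMap ∘ₗ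
      (PiLp.proj 2 (fun p : I => H p) s.1 : Sum H I →L[𝕜] H s.1).toLinearMap
  have hT (s) : (T s).ker.CoFG :=
    (((h _ _).add (hasFiniteRange_adjoint _ (h _ _))).comp_right _).cofg_ker
  have hA : (sInf (Set.range fun s => (T s).ker)).CoFG :=
    CoFG.sInf_of_finite (Set.finite_range _) (by rintro _ ⟨s, rfl⟩; exact hT s)
  refine LinearMap.FiniteRangeSetoid.equiv_iff_hasFiniteRange.mp
    (LinearMap.FiniteRangeSetoid.equiv_of_eqOn_coFG hA fun x hx => ?_)
  refine PiLp.ext fun q => ?_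
  change X.sumOp I J x q = Y.sumOp I J x q
  rw [sumOp_apply, sumOp_apply]
  refine Finset.sum_congr rfl fun p _ => ?_
  have hx' : T (p, q) x = 0 := (mem_sInf.mp hx) _ ⟨(p, q), rfl⟩
  have : X.d p q (x p) - Y.d p q (x p) +
      (adjoint (X.d q p) (x p) - adjoint (Y.d q p) (x p)) = 0 := by
    rw [← hx']
    simp [T]
  rw [← sub_eq_zero, ← this]
  abel

/-- The component of `sumOp` in degree `q`, on a vector restricted from a family in all degrees. -/
theorem sumOp_restrict_apply (X : HilbertSequence 𝕜 H n) {I J : Finset ℤ}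
    (hIJ : ∀ q ∈ J, ∀ p, p = q + 1 ∨ p = q - 1 → p ∈ I ∨ Subsingleton (H p))
    (z : ∀ p, H p) (q : J) :
    X.sumOp I J (WithLp.toLp 2 fun p : I => z p) q =
      X.d (q + 1) q (z (q + 1)) + adjoint (X.d q (q - 1)) (z (q - 1)) := by
  have hne : (q : ℤ) + 1 ≠ q - 1 := by omega
  rw [sumOp_apply]
  change ∑ p : I, (X.d p q (z p) + adjoint (X.d q p) (z p)) = _
  rw [Finset.sum_coe_sort I fun p => X.d p q (z p) + adjoint (X.d q p) (z p)]
  have hzero (p : ℤ) (hp : p ∉ ({(q : ℤ) + 1, (q : ℤ) - 1} : Finset ℤ)) :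
      X.d p q (z p) + adjoint (X.d q p) (z p) = 0 := by
    simp only [Finset.mem_insert, Finset.mem_singleton, not_or] at hp
    rw [X.shape p q (by omega), X.shape q p (by omega)]
    simp
  have hI (p : ℤ) (hp : p ∈ ({(q : ℤ) + 1, (q : ℤ) - 1} : Finset ℤ)) (hpI : p ∉ I) :
      X.d p q (z p) + adjoint (X.d q p) (z p) = 0 := by
    simp only [Finset.mem_insert, Finset.mem_singleton] at hp
    have : Subsingleton (H p) := (hIJ q q.2 p hp).resolve_left hpI
    rw [Subsingleton.elim (z p) 0]
    simp
  -- Both sums reduce to the intersection of the index sets: blocks vanish off `q ± 1`, and a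
  -- neighbour missing from `I` carries the zero space.
  have hsum : ∑ p ∈ I, (X.d p q (z p) + adjoint (X.d q p) (z p)) =
      ∑ p ∈ ({(q : ℤ) + 1, (q : ℤ) - 1} : Finset ℤ),
        (X.d p q (z p) + adjoint (X.d q p) (z p)) := by
    rw [← Finset.sum_subset (Finset.inter_subset_left (s₁ := I)) fun p hp hp' => hzero p fun h =>
        hp' (Finset.mem_inter.mpr ⟨hp, h⟩)]
    exact Finset.sum_subset Finset.inter_subset_right fun p hp hp' => hI p hp fun h =>
      hp' (Finset.mem_inter.mpr ⟨h, hp⟩)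
  rw [hsum, Finset.sum_pair hne, X.shape q (q + 1) (by omega), X.shape (q - 1) q (by omega)]
  simp

/-- The algebraic sum of the ranges of `δ_{q+1}` and `δ_q^*`. -/
abbrev totalRange (X : HilbertSequence 𝕜 H n) (q : ℤ) : Submodule 𝕜 (H q) :=
  X.R q ⊔ (adjoint (X.d q (q - 1))).range

/-- Write `y_q = u_q + v_q` along the two ranges. A preimage `z` is found degree by degree, from
`δ_p z_p = u_{p-1}` and `δ_{p+1}^* z_p = v_{p+1}`; these are compatible because the composites
vanish. -/
theorem mem_range_sumOp_iff (X : HilbertSequence 𝕜 H n)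
    (hd : ∀ p q r x, X.d q r (X.d p q x) = 0) {I J : Finset ℤ}
    (hIJ : ∀ q ∈ J, ∀ p, p = q + 1 ∨ p = q - 1 → p ∈ I ∨ Subsingleton (H p)) (y : Sum H J) :
    y ∈ (X.sumOp I J).range ↔ ∀ q : J, y q ∈ X.totalRange q := by
  classical
  constructor
  · rintro ⟨x, rfl⟩ q
    let z : ∀ p, H p := fun p => if h : p ∈ I then x ⟨p, h⟩ else 0
    have hx : x = WithLp.toLp 2 fun p : I => z p := by
      refine PiLp.ext fun p => ?_
      simp [z]
    rw [hx, coe_coe, X.sumOp_restrict_apply hIJ]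
    exact add_mem (mem_sup_left ⟨_, rfl⟩) (mem_sup_right ⟨_, rfl⟩)
  · intro hy
    have hex (q : ℤ) : ∃ u v : H q, u ∈ X.R q ∧ v ∈ (adjoint (X.d q (q - 1))).range ∧
        ∀ h : q ∈ J, u + v = y ⟨q, h⟩ := by
      by_cases h : q ∈ J
      · obtain ⟨u, hu, v, hv, huv⟩ := mem_sup.mp (hy ⟨q, h⟩)
        exact ⟨u, v, hu, hv, fun _ => huv⟩
      · exact ⟨0, 0, zero_mem _, zero_mem _, fun h' => absurd h' h⟩
    choose u v hu hv huv using hex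
    -- Stating the degrees through equations `q + 1 = p` and `r - 1 = p` avoids transport along `p -
    -- 1 + 1 = p`.
    have hex (p : ℤ) : ∃ z : H p, (∀ q, q + 1 = p → X.d p q z = u q) ∧
        ∀ r, r - 1 = p → adjoint (X.d r p) z = v r := by
      have h1 (q : ℤ) (hq : q + 1 = p) : u q ∈ (X.d p q).range := by subst hq; exact hu q
      have h2 (r : ℤ) (hr : r - 1 = p) : v r ∈ (adjoint (X.d r p)).range := by
        subst hr; exact hv r
      obtain ⟨z, hz1, hz2⟩ := exists_apply_eq_and_adjoint_apply_eq (X.d p (p - 1)) (X.d (p + 1) p)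
        (hd _ _ _) (h1 (p - 1) (by omega)) (h2 (p + 1) (by omega))
      refine ⟨z, fun q hq => ?_, fun r hr => ?_⟩
      · obtain rfl : q = p - 1 := by omega
        exact hz1
      · obtain rfl : r = p + 1 := by omega
        exact hz2
    choose z hz1 hz2 using hex
    refine ⟨WithLp.toLp 2 fun p : I => z p, PiLp.ext fun q => ?_⟩
    rw [coe_coe, X.sumOp_restrict_apply hIJ, hz1 _ _ rfl, hz2 _ _ rfl, huv q q.2]

/-- For a complex, the cokernel of `sumOp` is the product of the cokernels in each degree. -/
theorem nonempty_coker_sumOp_equiv (X : HilbertSequence 𝕜 H n)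
    (hd : ∀ p q r x, X.d q r (X.d p q x) = 0) {I J : Finset ℤ}
    (hIJ : ∀ q ∈ J, ∀ p, p = q + 1 ∨ p = q - 1 → p ∈ I ∨ Subsingleton (H p)) :
    Nonempty ((Sum H J ⧸ (X.sumOp I J).range) ≃ₗ[𝕜] ∀ q : J, H q ⧸ X.totalRange q) := by
  classical
  let e := WithLp.linearEquiv 2 𝕜 (∀ q : J, H q)
  have he : (X.sumOp I J).range.map e.toLinearMap =
      Submodule.pi Set.univ fun q : J => X.totalRange q := by
    ext y
    rw [mem_map_equiv, mem_range_sumOp_iff X hd hIJ]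
    simp [e]
  exact ⟨(Submodule.Quotient.equiv _ _ e he).trans (quotientPi _)⟩

/-- The relative dimension of the kernel and range of a complex, in case it has finite homology. -/
theorem nonempty_NQuot_equiv (X : HilbertSequence 𝕜 H n)
    (hd : ∀ p q r x, X.d q r (X.d p q x) = 0) (q : ℤ)
    (h : FiniteDimensional 𝕜 (X.NQuot (q - 1))) :
    Nonempty (X.NQuot q ≃ₗ[𝕜] H q ⧸ X.totalRange q) := by
  have hRN (q : ℤ) : X.R q ≤ X.N q := by
    rintro _ ⟨x, rfl⟩
    exact hd _ _ _ x
  -- `R(δ_q)` has finite codimension in the closed space `N(δ_{q-1})`. Closedness is what turns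
  -- `R(δ_q^*)` into the full complement `N(δ_q)ᗮ`.
  have hclosed : IsClosed ((X.d q (q - 1)).range : Set (H (q - 1))) := by
    obtain ⟨p, rfl⟩ : ∃ p, q = p + 1 := ⟨q - 1, by omega⟩
    have aux (r : ℤ) (hr : r = p) (hfin : FiniteDimensional 𝕜 (X.NQuot r)) :
        IsClosed ((X.d (p + 1) r).range : Set (H r)) := by
      subst hr
      let f : H (r + 1) →L[𝕜] X.N r := (X.d (r + 1) r).codRestrict _ fun x => hd _ _ _ x
      have hf : f.range = (X.N r ⊓ X.R r).submoduleOf (X.N r) := by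
        ext y
        constructor
        · rintro ⟨x, rfl⟩
          exact ⟨(f x).2, x, rfl⟩
        · rintro ⟨-, x, hx⟩
          exact ⟨x, Subtype.ext hx⟩
      have : CompleteSpace (X.N r) := (X.δ r).isClosed_ker.completeSpace_coe
      have hcl := f.isClosed_range_of_coFG (by rw [hf]; exact hfin)
      have himg : ((X.d (r + 1) r).range : Set (H r)) = Subtype.val '' (f.range : Set (X.N r)) := by
        ext y
        constructor
        · rintro ⟨x, rfl⟩
          exact ⟨f x, ⟨x, rfl⟩, rfl⟩
        · rintro ⟨_, ⟨x, rfl⟩, rfl⟩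
          exact ⟨x, rfl⟩
      rw [himg]
      exact ((X.δ r).isClosed_ker.isClosedEmbedding_subtypeVal.isClosedMap) _ hcl
    exact aux _ (by omega) h
  have : CompleteSpace (X.N q) := (X.δ q).isClosed_ker.completeSpace_coe
  rw [totalRange, range_adjoint_of_isClosed_range _ hclosed]
  obtain ⟨e⟩ := nonempty_quotient_sup_equiv_of_isCompl (X.N q).isCompl_orthogonal (hRN q)
  unfold NQuot
  rw [inf_eq_right.mpr (hRN q)]
  exact ⟨e⟩

/-- No closed range is available yet, but `R(δ_q^*) ⊆ N(δ_q)ᗮ` always meets `N(δ_q)` trivially,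
which suffices for finiteness. -/
theorem finite_NQuot (X : HilbertSequence 𝕜 H n)
    (hd : ∀ p q r x, X.d q r (X.d p q x) = 0) (q : ℤ)
    [FiniteDimensional 𝕜 (H q ⧸ X.totalRange q)] : FiniteDimensional 𝕜 (X.NQuot q) := by
  have hRN : X.R q ≤ X.N q := by
    rintro _ ⟨x, rfl⟩
    exact hd _ _ _ x
  have hdisj : Disjoint (X.N q) (adjoint (X.d q (q - 1))).range := by
    refine (X.N q).orthogonal_disjoint.mono_right ?_
    rw [N, orthogonal_ker]
    exact le_topologicalClosure _
  unfold NQuot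
  rw [inf_eq_right.mpr hRN]
  exact finite_quotient_submoduleOf_of_disjoint hdisj hRN

end HilbertSequence
end

/-! ### The theorem for complexes -/

noncomputable section

open Submodule ContinuousLinearMap

namespace HilbertSequence

variable {𝕜 : Type*} [RCLike 𝕜] {H : ℤ → Type*}
  [∀ p, NormedAddCommGroup (H p)] [∀ p, InnerProductSpace 𝕜 (H p)] {n : ℕ}

theorem mem_evens_or_mem_odds {q : ℤ} (h0 : 0 ≤ q) (hn : q ≤ n) : q ∈ evens n ∨ q ∈ odds n := by
  simp only [evens, odds, Finset.mem_filter, Finset.mem_Icc, h0, hn, true_and]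
  exact Int.even_or_odd q

theorem evens_neighbours (X : HilbertSequence 𝕜 H n) :
    ∀ q ∈ odds n, ∀ p, p = q + 1 ∨ p = q - 1 → p ∈ evens n ∨ Subsingleton (H p) := by
  intro q hq p hp
  simp only [odds, Finset.mem_filter] at hq
  by_cases h : 0 ≤ p ∧ p ≤ n
  · left
    simp only [evens, Finset.mem_filter, Finset.mem_Icc]
    exact ⟨h, by grind⟩
  · exact .inr (X.bounded p (by omega))

theorem odds_neighbours (X : HilbertSequence 𝕜 H n) :
    ∀ q ∈ evens n, ∀ p, p = q + 1 ∨ p = q - 1 → p ∈ odds n ∨ Subsingleton (H p) := by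
  intro q hq p hp
  simp only [evens, Finset.mem_filter] at hq
  by_cases h : 0 ≤ p ∧ p ≤ n
  · left
    simp only [odds, Finset.mem_filter, Finset.mem_Icc]
    exact ⟨h, by grind⟩
  · exact .inr (X.bounded p (by omega))

/-- An alternating sum over `0, …, n` splits into even and odd degrees. -/
theorem sum_range_neg_one_pow_mul (n : ℕ) (f : ℤ → ℤ) :
    ∑ p ∈ Finset.range (n + 1), (-1 : ℤ) ^ p * f p =
      ∑ q ∈ evens n, f q - ∑ q ∈ odds n, f q := by
  have hev : ∑ q ∈ evens n, f q = ∑ p ∈ Finset.range (n + 1) with Even p, f p := by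
    symm
    refine Finset.sum_bij (fun p _ => (p : ℤ)) ?_ (by simp) ?_ (by simp)
    · intro p hp
      simp only [Finset.mem_filter, Finset.mem_range] at hp
      simp only [evens, Finset.mem_filter, Finset.mem_Icc, Int.even_coe_nat]
      exact ⟨by omega, hp.2⟩
    · intro q hq
      simp only [evens, Finset.mem_filter, Finset.mem_Icc] at hq
      lift q to ℕ using hq.1.1
      exact ⟨q, by simp; grind, rfl⟩
  have hodd : ∑ q ∈ odds n, f q = ∑ p ∈ Finset.range (n + 1) with ¬ Even p, f p := by
    symm
    refine Finset.sum_bij (fun p _ => (p : ℤ)) ?_ (by simp) ?_ (by simp)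
    · intro p hp
      simp only [Finset.mem_filter, Finset.mem_range, Nat.not_even_iff_odd] at hp
      simp only [odds, Finset.mem_filter, Finset.mem_Icc, Int.odd_coe_nat]
      exact ⟨by omega, hp.2⟩
    · intro q hq
      simp only [odds, Finset.mem_filter, Finset.mem_Icc] at hq
      lift q to ℕ using hq.1.1
      exact ⟨q, by simp; grind, rfl⟩
  rw [hev, hodd, ← Finset.sum_filter_add_sum_filter_not _ (fun p => Even p), sub_eq_add_neg,
    ← Finset.sum_neg_distrib]
  congr 1 <;> refine Finset.sum_congr rfl fun p hp => ?_
  · rw [(Finset.mem_filter.mp hp).2.neg_one_pow, one_mul]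
  · rw [(Nat.not_even_iff_odd.mp (Finset.mem_filter.mp hp).2).neg_one_pow, neg_one_mul]

theorem subsingleton_RQuot (X : HilbertSequence 𝕜 H n)
    (hd : ∀ p q r x, X.d q r (X.d p q x) = 0) (q : ℤ) : Subsingleton (X.RQuot q) := by
  have hRN : X.R q ≤ X.N q := by
    rintro _ ⟨x, rfl⟩
    exact hd _ _ _ x
  rw [Submodule.Quotient.subsingleton_iff, submoduleOf_eq_top]
  exact le_inf hRN le_rfl

/-- Allowing every integer degree lets degree `q - 1` be used without boundary cases. -/
theorem isFredholmChain_iff_of_complex (X : HilbertSequence 𝕜 H n)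
    (hd : ∀ p q r x, X.d q r (X.d p q x) = 0) :
    X.IsFredholmChain ↔ ∀ q, FiniteDimensional 𝕜 (X.NQuot q) := by
  constructor
  · intro h q
    by_cases hq : 0 ≤ q ∧ q ≤ n
    · exact (h q hq.1 hq.2).1
    · have := X.bounded q (by omega)
      infer_instance
  · intro h q _ _
    have := X.subsingleton_RQuot hd q
    exact ⟨h q, inferInstance⟩

variable [∀ p, CompleteSpace (H p)]

theorem finite_coker_sumOp_iff (X : HilbertSequence 𝕜 H n)
    (hd : ∀ p q r x, X.d q r (X.d p q x) = 0) {I J : Finset ℤ}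
    (hIJ : ∀ q ∈ J, ∀ p, p = q + 1 ∨ p = q - 1 → p ∈ I ∨ Subsingleton (H p)) :
    (X.sumOp I J).range.CoFG ↔ ∀ q ∈ J, FiniteDimensional 𝕜 (H q ⧸ X.totalRange q) := by
  classical
  obtain ⟨e⟩ := X.nonempty_coker_sumOp_equiv hd hIJ
  constructor
  · intro h q hq
    have : Module.Finite 𝕜 (∀ q : J, H q ⧸ X.totalRange q) := Module.Finite.equiv e
    exact Module.Finite.of_surjective
      (LinearMap.proj (R := 𝕜) (φ := fun q : J => H q ⧸ X.totalRange q) ⟨q, hq⟩)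
      (LinearMap.proj_surjective _)
  · intro h
    have (q : J) : FiniteDimensional 𝕜 (H q ⧸ X.totalRange q) := h q q.2
    exact Module.Finite.equiv e.symm

theorem finrank_coker_sumOp (X : HilbertSequence 𝕜 H n)
    (hd : ∀ p q r x, X.d q r (X.d p q x) = 0) {I J : Finset ℤ}
    (hIJ : ∀ q ∈ J, ∀ p, p = q + 1 ∨ p = q - 1 → p ∈ I ∨ Subsingleton (H p))
    (h : ∀ q, FiniteDimensional 𝕜 (X.NQuot q)) :
    Module.finrank 𝕜 (Sum H J ⧸ (X.sumOp I J).range) =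
      ∑ q ∈ J, Module.finrank 𝕜 (X.NQuot q) := by
  obtain ⟨e⟩ := X.nonempty_coker_sumOp_equiv hd hIJ
  have hq (q : ℤ) := X.nonempty_NQuot_equiv hd q (h _)
  have (q : ℤ) : FiniteDimensional 𝕜 (H q ⧸ X.totalRange q) := by
    obtain ⟨e⟩ := hq q
    exact e.finiteDimensional
  rw [e.finrank_eq, Module.finrank_pi_fintype,
    Finset.sum_coe_sort J fun q => Module.finrank 𝕜 (H q ⧸ X.totalRange q)]
  refine Finset.sum_congr rfl fun q _ => ?_
  obtain ⟨e⟩ := hq q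
  exact e.finrank_eq.symm

/-- Each cokernel sees only one parity, while identifying it with homology in degree `q` needs
finiteness in degree `q - 1`; hence both operators are treated together. -/
theorem coFG_range_ops_iff (X : HilbertSequence 𝕜 H n)
    (hd : ∀ p q r x, X.d q r (X.d p q x) = 0) :
    X.evenOp.range.CoFG ∧ X.oddOp.range.CoFG ↔ ∀ q, FiniteDimensional 𝕜 (X.NQuot q) := by
  rw [evenOp, oddOp, X.finite_coker_sumOp_iff hd X.evens_neighbours,
    X.finite_coker_sumOp_iff hd X.odds_neighbours]
  constructor
  · rintro ⟨h1, h2⟩ q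
    by_cases hq : 0 ≤ q ∧ q ≤ n
    · have : FiniteDimensional 𝕜 (H q ⧸ X.totalRange q) := by
        rcases mem_evens_or_mem_odds hq.1 hq.2 with h | h
        exacts [h2 q h, h1 q h]
      exact X.finite_NQuot hd q
    · have := X.bounded q (by omega)
      infer_instance
  · intro h
    have (q : ℤ) : FiniteDimensional 𝕜 (H q ⧸ X.totalRange q) := by
      obtain ⟨e⟩ := X.nonempty_NQuot_equiv hd q (h _)
      exact e.finiteDimensional
    exact ⟨fun q _ => this q, fun q _ => this q⟩

theorem adjoint_evenOp (X : HilbertSequence 𝕜 H n) : adjoint X.evenOp = X.oddOp :=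
  X.adjoint_sumOp _ _

theorem adjoint_oddOp (X : HilbertSequence 𝕜 H n) : adjoint X.oddOp = X.evenOp :=
  X.adjoint_sumOp _ _

theorem isFredholm_evenOp_iff_of_complex (X : HilbertSequence 𝕜 H n)
    (hd : ∀ p q r x, X.d q r (X.d p q x) = 0) : X.evenOp.IsFredholm ↔ X.IsFredholmChain := by
  rw [isFredholm_iff_coFG_range, adjoint_evenOp, X.coFG_range_ops_iff hd,
    X.isFredholmChain_iff_of_complex hd]

theorem isFredholm_oddOp_iff_of_complex (X : HilbertSequence 𝕜 H n)
    (hd : ∀ p q r x, X.d q r (X.d p q x) = 0) : X.oddOp.IsFredholm ↔ X.IsFredholmChain := by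
  rw [isFredholm_iff_coFG_range, adjoint_oddOp, and_comm, X.coFG_range_ops_iff hd,
    X.isFredholmChain_iff_of_complex hd]

theorem index_eq_of_complex (X : HilbertSequence 𝕜 H n)
    (hd : ∀ p q r x, X.d q r (X.d p q x) = 0) (h : X.IsFredholmChain) :
    X.index = X.evenOp.toLinearMap.index ∧ X.index = -X.oddOp.toLinearMap.index := by
  have hfin := (X.isFredholmChain_iff_of_complex hd).mp h
  obtain ⟨h1, h2⟩ := (X.coFG_range_ops_iff hd).mpr hfin
  have hind : X.index = (Module.finrank 𝕜 (Sum H (evens n) ⧸ X.oddOp.range) : ℤ) -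
      Module.finrank 𝕜 (Sum H (odds n) ⧸ X.evenOp.range) := by
    rw [oddOp, evenOp, X.finrank_coker_sumOp hd X.odds_neighbours hfin,
      X.finrank_coker_sumOp hd X.evens_neighbours hfin]
    push_cast
    rw [← sum_range_neg_one_pow_mul n fun q => (Module.finrank 𝕜 (X.NQuot q) : ℤ), index]
    refine Finset.sum_congr rfl fun p _ => ?_
    have := X.subsingleton_RQuot hd p
    rw [Module.finrank_zero_of_subsingleton (M := X.RQuot p)]
    simp
  rw [index_eq_finrank_coker_adjoint_sub X.evenOp (by rwa [adjoint_evenOp]),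
    index_eq_finrank_coker_adjoint_sub X.oddOp (by rwa [adjoint_oddOp]), adjoint_evenOp,
    adjoint_oddOp, hind]
  exact ⟨rfl, by ring⟩

end HilbertSequence
end

/-! ### Reduction of a general sequence to a complex -/

noncomputable section

open Submodule ContinuousLinearMap

namespace HilbertSequence

variable {𝕜 : Type*} [RCLike 𝕜] {H : ℤ → Type*}
  [∀ p, NormedAddCommGroup (H p)] [∀ p, InnerProductSpace 𝕜 (H p)] {n : ℕ}
  [∀ p, CompleteSpace (H p)]

/-- The complex with differentials `P_{N(δ_{p-1})} δ_p`. -/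
def toComplex (X : HilbertSequence 𝕜 H n) : HilbertSequence 𝕜 H n where
  d p q := (X.N q).starProjection ∘L X.d p q
  shape p q h := by rw [X.shape p q h, comp_zero]
  bounded := X.bounded

theorem toComplex_d_apply (X : HilbertSequence 𝕜 H n) (p q : ℤ) (x : H p) :
    X.toComplex.d p q x = (X.N q).starProjection (X.d p q x) := rfl

theorem toComplex_d_mem (X : HilbertSequence 𝕜 H n) (p q : ℤ) (x : H p) :
    X.toComplex.d p q x ∈ X.N q :=
  starProjection_apply_mem _ _

theorem toComplex_d_d (X : HilbertSequence 𝕜 H n) (p q r : ℤ) (x : H p) :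
    X.toComplex.d q r (X.toComplex.d p q x) = 0 := by
  have h : X.d q r (X.toComplex.d p q x) = 0 := by
    by_cases hr : r + 1 = q
    · obtain rfl : r = q - 1 := by omega
      exact X.toComplex_d_mem p q x
    · rw [X.shape q r hr, zero_apply]
  rw [toComplex_d_apply, h, map_zero]

theorem hasFiniteRange_d_sub_toComplex (X : HilbertSequence 𝕜 H n)
    (hX : ∀ p : ℤ, FiniteDimensional 𝕜 (X.δ p ∘L X.d (p + 1) p).range) (p q : ℤ) :
    (X.d p q - X.toComplex.d p q).toLinearMap.HasFiniteRange := by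
  by_cases hp : q + 1 = p
  · subst hp
    rw [← LinearMap.ker_coFG_iff_hasFiniteRange]
    have hK : (X.δ q ∘L X.d (q + 1) q).ker.CoFG :=
      LinearMap.HasFiniteRange.cofg_ker ((fg_iff_finiteDimensional _).mpr (hX q))
    refine hK.of_le fun x hx => ?_
    have hx' : X.d (q + 1) q x ∈ X.N q := hx
    change X.d (q + 1) q x - X.toComplex.d (q + 1) q x = 0
    rw [toComplex_d_apply, starProjection_eq_self_iff.mpr hx', sub_self]
  · rw [X.shape p q hp, X.toComplex.shape p q hp, sub_zero]
    exact LinearMap.HasFiniteRange.zero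

/-- The defect `dim N'_p / N_p` between the kernels of the complex and of the given sequence. -/
def kerDefect (X : HilbertSequence 𝕜 H n) (p : ℤ) : ℕ :=
  Module.finrank 𝕜 (X.toComplex.N p ⧸ (X.N p).submoduleOf (X.toComplex.N p))

theorem N_le_toComplex_N (X : HilbertSequence 𝕜 H n) (p : ℤ) : X.N p ≤ X.toComplex.N p := by
  intro x hx
  have hx' : X.d p (p - 1) x = 0 := hx
  change X.toComplex.d p (p - 1) x = 0
  rw [toComplex_d_apply, hx', map_zero]

/-- Supplies the end terms `p = 0` (zero target) and `p = n + 1` (zero source) of the telescoping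
sum. -/
theorem kerDefect_eq_zero (X : HilbertSequence 𝕜 H n) (p : ℤ) (hp : p ≤ 0 ∨ (n : ℤ) + 1 ≤ p) :
    X.kerDefect p = 0 := by
  have h : X.toComplex.N p ≤ X.N p := by
    intro x _
    rcases hp with hp | hp
    · have := X.bounded (p - 1) (by omega)
      exact Subsingleton.elim _ _
    · have := X.bounded p (by omega)
      rw [Subsingleton.elim x 0]
      exact zero_mem _
  have : Subsingleton (X.toComplex.N p ⧸ (X.N p).submoduleOf (X.toComplex.N p)) := by
    rwa [Submodule.Quotient.subsingleton_iff, submoduleOf_eq_top]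
  exact Module.finrank_zero_of_subsingleton

/-- Comparison of the ranges in degree `p` and the kernels in degree `p + 1`. -/
theorem finrank_RQuot_eq (X : HilbertSequence 𝕜 H n)
    (hX : ∀ p : ℤ, FiniteDimensional 𝕜 (X.δ p ∘L X.d (p + 1) p).range) (p : ℤ) :
    FiniteDimensional 𝕜 (X.RQuot p) ∧
    FiniteDimensional 𝕜 (X.toComplex.R p ⧸ (X.N p ⊓ X.R p).submoduleOf (X.toComplex.R p)) ∧
    FiniteDimensional 𝕜 (X.toComplex.N (p + 1) ⧸ (X.N (p + 1)).submoduleOf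
      (X.toComplex.N (p + 1))) ∧
    Module.finrank 𝕜 (X.RQuot p) =
      Module.finrank 𝕜 (X.toComplex.R p ⧸ (X.N p ⊓ X.R p).submoduleOf (X.toComplex.R p)) +
        X.kerDefect (p + 1) := by
  -- On `K = N(δ_p δ_{p+1})` the projection acts trivially, so `δ_{p+1}` and `δ'_{p+1}` agree there,
  -- and `δ_{p+1}(K) = N(δ_p) ∩ R(δ_{p+1})`.
  set K := (X.δ p ∘L X.d (p + 1) p).ker
  have hmemK (x : H (p + 1)) : x ∈ K ↔ X.d (p + 1) p x ∈ X.N p := Iff.rfl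
  have hK : FiniteDimensional 𝕜 (H (p + 1) ⧸ K) :=
    LinearMap.HasFiniteRange.cofg_ker ((fg_iff_finiteDimensional _).mpr (hX p))
  have heq (x) (hx : x ∈ K) : X.d (p + 1) p x = X.toComplex.d (p + 1) p x := by
    rw [toComplex_d_apply, starProjection_eq_self_iff.mpr ((hmemK x).mp hx)]
  have hfK : (X.d (p + 1) p).ker ≤ K := by
    intro x hx
    have hx' : X.d (p + 1) p x = 0 := hx
    rw [hmemK, hx']
    exact zero_mem _
  have hker : (X.toComplex.d (p + 1) p).ker ⊓ K = (X.d (p + 1) p).ker := by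
    ext x
    constructor
    · rintro ⟨h1, h2⟩
      exact (heq x h2).trans h1
    · intro hx
      exact ⟨(heq x (hfK hx)).symm.trans hx, hfK hx⟩
  have hmap : K.map (X.d (p + 1) p).toLinearMap = X.N p ⊓ X.R p := by
    ext y
    constructor
    · rintro ⟨x, hx, rfl⟩
      exact ⟨hx, x, rfl⟩
    · rintro ⟨hy, x, rfl⟩
      exact ⟨x, hy, rfl⟩
  have hN (Y : HilbertSequence 𝕜 H n) : Y.N (p + 1) = (Y.d (p + 1) p).ker := by
    have aux (r : ℤ) (hr : r = p) : (Y.d (p + 1) r).ker = (Y.d (p + 1) p).ker := by subst hr; rfl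
    exact aux _ (by omega)
  have := LinearMap.finite_and_finrank_of_eqOn (f := (X.d (p + 1) p).toLinearMap)
    (g := (X.toComplex.d (p + 1) p).toLinearMap) heq hfK hker
  rw [hmap] at this
  unfold kerDefect
  rw [hN, hN]
  exact this

/-- With `C = N ∩ R`, compare the towers `C ≤ N ≤ N'` and `C ≤ R' ≤ N'`, primes denoting the
complex: both compute `dim N'/C`, and `dim R'/C` cancels against `finrank_RQuot_eq`. -/
theorem finrank_toComplex_NQuot (X : HilbertSequence 𝕜 H n)
    (hX : ∀ p : ℤ, FiniteDimensional 𝕜 (X.δ p ∘L X.d (p + 1) p).range) (p : ℤ) :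
    (FiniteDimensional 𝕜 (X.NQuot p) ↔ FiniteDimensional 𝕜 (X.toComplex.NQuot p)) ∧
    (FiniteDimensional 𝕜 (X.NQuot p) →
      (Module.finrank 𝕜 (X.NQuot p) : ℤ) - Module.finrank 𝕜 (X.RQuot p) =
        Module.finrank 𝕜 (X.toComplex.NQuot p) - X.kerDefect p - X.kerDefect (p + 1)) := by
  obtain ⟨-, hb, -, hr⟩ := X.finrank_RQuot_eq hX p
  have ha : FiniteDimensional 𝕜 (X.toComplex.N p ⧸ (X.N p).submoduleOf (X.toComplex.N p)) := by
    obtain ⟨q, rfl⟩ : ∃ q, p = q + 1 := ⟨p - 1, by omega⟩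
    exact (X.finrank_RQuot_eq hX q).2.2.1
  have hRN' : X.toComplex.R p ≤ X.toComplex.N p := by
    rintro _ ⟨x, rfl⟩
    exact X.toComplex_d_d _ _ _ x
  have hcR' : X.N p ⊓ X.R p ≤ X.toComplex.R p := by
    rintro _ ⟨hy, x, rfl⟩
    refine ⟨x, ?_⟩
    change (X.N p).starProjection (X.d (p + 1) p x) = _
    exact starProjection_eq_self_iff.mpr hy
  obtain ⟨t1, t2⟩ := finite_and_finrank_quotient_tower
    (inf_le_left : X.N p ⊓ X.R p ≤ X.N p) (X.N_le_toComplex_N p)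
  obtain ⟨s1, s2⟩ := finite_and_finrank_quotient_tower hcR' hRN'
  have hinf : X.toComplex.N p ⊓ X.toComplex.R p = X.toComplex.R p := inf_eq_right.mpr hRN'
  unfold NQuot
  rw [hinf]
  refine ⟨⟨fun h => (s1.mp (t1.mpr ⟨ha, h⟩)).1, fun h => (t1.mp (s1.mpr ⟨h, hb⟩)).2⟩, fun h => ?_⟩
  have hfin := t1.mpr ⟨ha, h⟩
  have e1 := t2 hfin
  have e2 := s2 hfin
  unfold kerDefect at hr ⊢
  omega

theorem isFredholmChain_toComplex_iff (X : HilbertSequence 𝕜 H n)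
    (hX : ∀ p : ℤ, FiniteDimensional 𝕜 (X.δ p ∘L X.d (p + 1) p).range) :
    X.toComplex.IsFredholmChain ↔ X.IsFredholmChain := by
  refine forall_congr' fun p => forall_congr' fun _ => forall_congr' fun _ => ?_
  have h1 := (X.finrank_RQuot_eq hX p).1
  have h2 := X.toComplex.subsingleton_RQuot X.toComplex_d_d p
  rw [(X.finrank_toComplex_NQuot hX p).1]
  exact ⟨fun h => ⟨h.1, h1⟩, fun h => ⟨h.1, inferInstance⟩⟩

theorem index_toComplex (X : HilbertSequence 𝕜 H n)
    (hX : ∀ p : ℤ, FiniteDimensional 𝕜 (X.δ p ∘L X.d (p + 1) p).range)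
    (h : X.IsFredholmChain) : X.toComplex.index = X.index := by
  have htel (m : ℕ) : ∑ p ∈ Finset.range m, (-1 : ℤ) ^ p *
      ((X.kerDefect p : ℤ) + X.kerDefect ((p : ℤ) + 1)) =
        X.kerDefect 0 - (-1) ^ m * X.kerDefect m := by
    induction m with
    | zero => simp
    | succ m ih =>
      rw [Finset.sum_range_succ, ih]
      push_cast
      ring
  have h0 := htel (n + 1)
  rw [X.kerDefect_eq_zero 0 (.inl le_rfl),
    X.kerDefect_eq_zero _ (.inr (by push_cast; exact le_rfl))] at h0
  have key : X.toComplex.index = X.index + ∑ p ∈ Finset.range (n + 1), (-1 : ℤ) ^ p *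
      ((X.kerDefect p : ℤ) + X.kerDefect ((p : ℤ) + 1)) := by
    rw [index, index, ← Finset.sum_add_distrib]
    refine Finset.sum_congr rfl fun p hp => ?_
    have hp' := Finset.mem_range.mp hp
    have := X.toComplex.subsingleton_RQuot X.toComplex_d_d p
    rw [(X.finrank_toComplex_NQuot hX p).2 (h p (by omega) (by omega)).1,
      Module.finrank_zero_of_subsingleton (M := X.toComplex.RQuot p)]
    push_cast
    ring
  rw [key, h0]
  simp

theorem isFredholm_sumOp_toComplex_iff (X : HilbertSequence 𝕜 H n)
    (hX : ∀ p : ℤ, FiniteDimensional 𝕜 (X.δ p ∘L X.d (p + 1) p).range) (I J : Finset ℤ) :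
    (X.toComplex.sumOp I J).IsFredholm ↔ (X.sumOp I J).IsFredholm := by
  have h := hasFiniteRange_sumOp_sub X X.toComplex (X.hasFiniteRange_d_sub_toComplex hX) I J
  refine ⟨fun hF => hF.congr h, fun hF => hF.congr ?_⟩
  have := h.neg
  rwa [← ContinuousLinearMap.toLinearMap_neg, neg_sub] at this

theorem index_sumOp_toComplex (X : HilbertSequence 𝕜 H n)
    (hX : ∀ p : ℤ, FiniteDimensional 𝕜 (X.δ p ∘L X.d (p + 1) p).range) {I J : Finset ℤ}
    (h : (X.sumOp I J).IsFredholm) :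
    (X.toComplex.sumOp I J).toLinearMap.index = (X.sumOp I J).toLinearMap.index := by
  have h' := (X.isFredholm_sumOp_toComplex_iff hX I J).mpr h
  have := h.finite_ker
  have := h.finite_coker
  have := h'.finite_ker
  have := h'.finite_coker
  exact (LinearMap.index_eq_of_hasFiniteRange_sub
    (hasFiniteRange_sumOp_sub X X.toComplex (X.hasFiniteRange_d_sub_toComplex hX) I J)).symm

end HilbertSequence
end

theorem theorem6p2 {𝕜 : Type*} [RCLike 𝕜] {H : ℤ → Type*}
    [∀ p, NormedAddCommGroup (H p)] [∀ p, InnerProductSpace 𝕜 (H p)] [∀ p, CompleteSpace (H p)]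
    {n : ℕ} (X : HilbertSequence 𝕜 H n)
    (hX : ∀ p : ℤ, FiniteDimensional 𝕜 (X.δ p ∘L X.d (p + 1) p).range) :
    (X.IsFredholmChain ↔ X.evenOp.IsFredholm) ∧
    (X.IsFredholmChain ↔ X.oddOp.IsFredholm) ∧
    (X.IsFredholmChain →
      X.index = X.evenOp.toLinearMap.index ∧ X.index = -X.oddOp.toLinearMap.index) := by
  have hev : X.IsFredholmChain ↔ X.evenOp.IsFredholm := by
    rw [← X.isFredholmChain_toComplex_iff hX,
      ← X.toComplex.isFredholm_evenOp_iff_of_complex X.toComplex_d_d]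
    exact X.isFredholm_sumOp_toComplex_iff hX _ _
  have hodd : X.IsFredholmChain ↔ X.oddOp.IsFredholm := by
    rw [← X.isFredholmChain_toComplex_iff hX,
      ← X.toComplex.isFredholm_oddOp_iff_of_complex X.toComplex_d_d]
    exact X.isFredholm_sumOp_toComplex_iff hX _ _
  refine ⟨hev, hodd, fun h => ?_⟩
  obtain ⟨h1, h2⟩ := X.toComplex.index_eq_of_complex X.toComplex_d_d
    ((X.isFredholmChain_toComplex_iff hX).mpr h)
  have e1 : X.toComplex.evenOp.toLinearMap.index = X.evenOp.toLinearMap.index :=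
    X.index_sumOp_toComplex hX (hev.mp h)
  have e2 : X.toComplex.oddOp.toLinearMap.index = X.oddOp.toLinearMap.index :=
    X.index_sumOp_toComplex hX (hodd.mp h)
  rw [← X.index_toComplex hX h]
  exact ⟨h1.trans e1, h2.trans (by rw [e2])⟩
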